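/- For each sample size $n$ let $p=p_n$ be a positive integer, let $\Sigma^*=\Sigma^*_n$ be a positive definite $p\times p$ covariance matrix with inverse $\Omega^*$, and let $X^n=(X_1,\dots,X_n)$ be i.i.d. $N(0,\Sigma^*)$; $o_P(1)$ refers to the law of $X^n$ as $n\to\infty$. Let $\hat\Sigma=\frac1n\sum_{i=1}^nX_iX_i^T$ and $$l_n(\Omega)=\frac n2\log\det(\Omega)-\frac n2\,\mathrm{tr}(\Omega\hat\Sigma).$$ Let $\Pi=\Pi_n$ be a prior probability distribution on positive definite precision matrices $\Omega=\Sigma^{-1}$, with posterior $$\Pi(B\mid X^n)=\frac{\int_B\exp(l_n(\Omega))\,d\Pi(\Omega)}{\int\exp(l_n(\Omega))\,d\Pi(\Omega)}.$$ Write $\|\cdot\|$ for the spectral norm and $\|\cdot\|_F$ for the Frobenius norm. Let $\phi=\phi_n$ be a real (measurable) functional of the covariance matrix, $\Phi=\Phi_n$ a nonzero symmetric $p\times p$ matrix, and $A_n$ a (measurable) set of positive definite precision matrices such that $A_n\subset\{\|\Sigma-\Sigma^*\|\le\delta_n\}$ for some sequence $\delta_n=o(1)$ and $$\sup_{A_n}\sqrt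 n\,\bigl\|\Sigma^{*1/2}\Phi\Sigma^{*1/2}\bigr\|_F^{-1}\Bigl|\phi(\Sigma)-\phi(\hat\Sigma)-\mathrm{tr}\bigl((\Sigma-\hat\Sigma)\Phi\bigr)\Bigr|=o_P(1).$$ Assume $\|\Sigma^*\|\vee\|\Omega^*\|=O(1)$ and 1. $\Pi(A_n\mid X^n)=1-o_P(1)$; 2. for every fixed $t\in\mathbb R$, $$\frac{\int_{A_n}\exp(l_n(\Omega_t))\,d\Pi(\Omega)}{\int_{A_n}\exp(l_n(\Omega))\,d\Pi(\Omega)}=1+o_P(1),\qquad \Omega_t=\Omega+\frac{\sqrt2\,t}{\sqrt n\,\|\Sigma^{*1/2}\Phi\Sigma^{*1/2}\|_F}\,\Phi .$$ Then $$\sup_{t\in\mathbb R}\left|\Pi\left(\frac{\sqrt n\,\bigl(\phi(\Sigma)-\phi(\hat\Sigma)\bigr)}{\sqrt2\,\|\Sigma^{*1/2}\Phi\Sigma^{*1/2}\|_F}\le t\;\Big|\;X^n\right)-\mathbb P(Z\le t)\right|=o_P(1),\qquad Z\sim N(0,1).$$ -/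

import Mathlib

open Asymptotics MeasureTheory ProbabilityTheory Filter Topology
open scoped ENNReal

noncomputable section

namespace CovBvM

/-- The Borel `σ`-algebra on matrices, that is, the product `σ`-algebra of the entries. -/
instance matrixMeasurableSpace {p : ℕ} : MeasurableSpace (Matrix (Fin p) (Fin p) ℝ) :=
  inferInstanceAs (MeasurableSpace (Fin p → Fin p → ℝ))

/-- Spectral norm: the operator norm on Euclidean space. -/
def specNorm {p : ℕ} (M : Matrix (Fin p) (Fin p) ℝ) : ℝ :=
  ‖Matrix.toEuclideanCLM (n := Fin p) (𝕜 := ℝ) M‖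

/-- Frobenius norm. -/
def frobeniusNorm {p : ℕ} (M : Matrix (Fin p) (Fin p) ℝ) : ℝ :=
  Real.sqrt (∑ i, ∑ j, M i j ^ 2)

open scoped MatrixOrder in
/-- `‖S^{1/2} Φ S^{1/2}‖_F`, where `S^{1/2}` is the positive semidefinite square root. -/
def weightedNorm {p : ℕ} (S Φ : Matrix (Fin p) (Fin p) ℝ) : ℝ :=
  frobeniusNorm (CFC.sqrt S * Φ * CFC.sqrt S)

/-- Samples of size `n` in dimension `p`. -/
abbrev Sample (n p : ℕ) : Type := Fin n → EuclideanSpace ℝ (Fin p)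

/-- The law of `n` i.i.d. `N(0, S)` vectors. -/
def sampleLaw (n : ℕ) {p : ℕ} (S : Matrix (Fin p) (Fin p) ℝ) : Measure (Sample n p) :=
  Measure.pi fun _ : Fin n => multivariateGaussian 0 S

/-- Sample covariance (mean known to be zero): `n⁻¹ ∑ᵢ Xᵢ Xᵢᵀ`. -/
def sampleCov {n p : ℕ} (x : Sample n p) : Matrix (Fin p) (Fin p) ℝ :=
  Matrix.of fun a b => (∑ i, x i a * x i b) / (n : ℝ)

/-- Gaussian log-likelihood of the precision matrix `Ω`, up to the additive constant. -/
def logLik {n p : ℕ} (x : Sample n p) (Ω : Matrix (Fin p) (Fin p) ℝ) : ℝ :=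
  (n : ℝ) / 2 * Real.log Ω.det - (n : ℝ) / 2 * (Ω * sampleCov x).trace

/-- Posterior probability of a set `B` of precision matrices. The integrals take values in
`[0, ∞]`; if the normalizing integral is infinite (no posterior exists), the value is `0`. -/
def posteriorProb {n p : ℕ} (prior : Measure (Matrix (Fin p) (Fin p) ℝ)) (x : Sample n p)
    (B : Set (Matrix (Fin p) (Fin p) ℝ)) : ℝ :=
  ((∫⁻ Ω in B, ENNReal.ofReal (Real.exp (logLik x Ω)) ∂prior) /
    ∫⁻ Ω, ENNReal.ofReal (Real.exp (logLik x Ω)) ∂prior).toReal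

/-- The perturbed precision matrix `Ω + √2 t / (√n ‖S^{1/2} Φ S^{1/2}‖_F) Φ`. -/
def perturbed (n : ℕ) {p : ℕ} (S Φ : Matrix (Fin p) (Fin p) ℝ) (t : ℝ)
    (Ω : Matrix (Fin p) (Fin p) ℝ) : Matrix (Fin p) (Fin p) ℝ :=
  Ω + (Real.sqrt 2 * t / (Real.sqrt n * weightedNorm S Φ)) • Φ

/-- `∫_A exp(l_n(Ω_t)) dΠ(Ω) / ∫_A exp(l_n(Ω)) dΠ(Ω)`. -/
def likelihoodRatio {n p : ℕ} (prior : Measure (Matrix (Fin p) (Fin p) ℝ)) (x : Sample n p)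
    (A : Set (Matrix (Fin p) (Fin p) ℝ)) (S Φ : Matrix (Fin p) (Fin p) ℝ) (t : ℝ) : ℝ :=
  ((∫⁻ Ω in A, ENNReal.ofReal (Real.exp (logLik x (perturbed n S Φ t Ω))) ∂prior) /
    ∫⁻ Ω in A, ENNReal.ofReal (Real.exp (logLik x Ω)) ∂prior).toReal

/-- `Y n = o_P(1)` under `P n`, for `[0, ∞]`-valued quantities on a sequence of probability
spaces (in outer probability where `Y n` is not measurable). -/
def IsLittleOP {E : ℕ → Type*} [∀ n, MeasurableSpace (E n)] (P : ∀ n, Measure (E n))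
    (Y : ∀ n, E n → ℝ≥0∞) : Prop :=
  ∀ ε : ℝ≥0∞, 0 < ε → Tendsto (fun n => P n {x | ε ≤ Y n x}) atTop (𝓝 0)

end CovBvM

end

open CovBvM

/-!
Put `a = ‖S^{1/2} Φ S^{1/2}‖_F` with `S = Σ*`. Diagonalizing `Ω^{-1/2} Φ Ω^{-1/2}` turns the
log-determinant into a sum of scalar logarithms, and the second-order expansion of the latter gives,
uniformly over `A_n`, `l_n(Ω_t) - l_n(Ω) = t T(Ω) - t²/2 + o_P(1)`, where `T` is the rescaled
functional: the quadratic term is `t²/2` because `‖Ω^{-1/2} Φ Ω^{-1/2}‖_F / a → 1` on `A_n`.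
Hence the moment generating function at `t` of `T` under the posterior restricted to `A_n` is
`e^{t²/2}` times the likelihood ratio of condition 2, up to a factor `1 + o_P(1)`, and converges to
that of `N(0, 1)`.

Convergence of moment generating functions implies weak convergence: exponential moments give
tightness, and they pass to every limit point, which they determine. As the Gaussian distribution
function is continuous, convergence of distribution functions is uniform. Restricting the posterior
to `A_n` changes probabilities by at most `1 - Π(A_n | X^n)`. Stochastic limits are taken along the
filter of events whose probability tends to one, so no subsequences are needed.
-/

namespace CovBvM

section LogDet

lemma abs_log_one_add_sub_le {u : ℝ} (hu : |u| ≤ 1 / 2) :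
    |Real.log (1 + u) - u + u ^ 2 / 2| ≤ 2 * |u| ^ 3 := by
  have taylor := Real.abs_log_sub_add_sum_range_le (x := -u) (by rw [abs_neg]; linarith) 2
  have tail : |u| ^ 3 / (1 - |u|) ≤ 2 * |u| ^ 3 := by
    rw [div_le_iff₀ (by linarith)]
    nlinarith [pow_nonneg (abs_nonneg u) 3]
  norm_num [Finset.sum_range_succ] at taylor
  refine le_trans (le_of_eq ?_) (taylor.trans tail)
  congr 1
  ring

lemma det_one_add_eq_prod_eigenvalues {ι : Type*} [Fintype ι] [DecidableEq ι] {M : Matrix ι ι ℝ}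
    (hM : M.IsHermitian) : (1 + M).det = ∏ i, (1 + hM.eigenvalues i) := by
  have diagonalize : 1 + M = Unitary.conjStarAlgAut ℝ _ hM.eigenvectorUnitary
      (Matrix.diagonal fun i => 1 + hM.eigenvalues i) := by
    conv_lhs => rw [hM.spectral_theorem, ← map_one (Unitary.conjStarAlgAut ℝ _ _), ← map_add,
      ← Matrix.diagonal_one, Matrix.diagonal_add]
    rfl
  rw [diagonalize, Unitary.conjStarAlgAut_apply, Matrix.det_mul_right_comm]
  simp

lemma trace_mul_self_eq_sum_eigenvalues_sq {ι : Type*} [Fintype ι] [DecidableEq ι]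
    {M : Matrix ι ι ℝ} (hM : M.IsHermitian) : (M * M).trace = ∑ i, hM.eigenvalues i ^ 2 := by
  conv_lhs => rw [hM.spectral_theorem, ← map_mul, Unitary.conjStarAlgAut_apply,
    Matrix.trace_mul_cycle]
  simp [Matrix.trace, sq]

variable {p : ℕ} {M : Matrix (Fin p) (Fin p) ℝ}

lemma frobeniusNorm_nonneg (M : Matrix (Fin p) (Fin p) ℝ) : 0 ≤ frobeniusNorm M :=
  Real.sqrt_nonneg _

lemma frobeniusNorm_smul (c : ℝ) (M : Matrix (Fin p) (Fin p) ℝ) :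
    frobeniusNorm (c • M) = |c| * frobeniusNorm M := by
  simp only [frobeniusNorm, Matrix.smul_apply, smul_eq_mul, mul_pow, ← Finset.mul_sum]
  rw [Real.sqrt_mul (sq_nonneg c), Real.sqrt_sq_eq_abs]

lemma frobeniusNorm_eq_zero_iff : frobeniusNorm M = 0 ↔ M = 0 := by
  rw [frobeniusNorm, Real.sqrt_eq_zero (by positivity),
    Finset.sum_eq_zero_iff_of_nonneg fun _ _ => by positivity]
  simp only [Finset.sum_eq_zero_iff_of_nonneg fun _ _ => sq_nonneg _, Finset.mem_univ,
    forall_const, pow_eq_zero_iff two_ne_zero, ← Matrix.ext_iff, Matrix.zero_apply]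

lemma frobeniusNorm_sq (hM : M.IsHermitian) : frobeniusNorm M ^ 2 = (M * M).trace := by
  rw [frobeniusNorm, Real.sq_sqrt (by positivity)]
  simp only [Matrix.trace, Matrix.diag_apply, Matrix.mul_apply]
  refine Finset.sum_congr rfl fun i _ => Finset.sum_congr rfl fun j _ => ?_
  rw [sq, ← hM.apply j i, star_trivial]

lemma abs_eigenvalues_le_frobeniusNorm (hM : M.IsHermitian) (i : Fin p) :
    |hM.eigenvalues i| ≤ frobeniusNorm M := by
  refine abs_le_of_sq_le_sq ?_ (frobeniusNorm_nonneg M)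
  rw [frobeniusNorm_sq hM, trace_mul_self_eq_sum_eigenvalues_sq hM]
  exact Finset.single_le_sum (f := fun i => hM.eigenvalues i ^ 2) (fun _ _ => sq_nonneg _)
    (Finset.mem_univ i)

lemma one_add_eigenvalues_pos (hM : M.IsHermitian) (hM' : frobeniusNorm M < 1) (i : Fin p) :
    0 < 1 + hM.eigenvalues i := by
  linarith [neg_le_of_abs_le (abs_eigenvalues_le_frobeniusNorm hM i)]

lemma det_one_add_pos (hM : M.IsHermitian) (hM' : frobeniusNorm M < 1) : 0 < (1 + M).det := by
  rw [det_one_add_eq_prod_eigenvalues hM]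
  exact Finset.prod_pos fun i _ => one_add_eigenvalues_pos hM hM' i

lemma abs_log_det_one_add_sub_le (hM : M.IsHermitian) (hM' : frobeniusNorm M ≤ 1 / 2) :
    |Real.log (1 + M).det - M.trace + frobeniusNorm M ^ 2 / 2| ≤ 2 * frobeniusNorm M ^ 3 := by
  set ev := hM.eigenvalues
  have ev_le : ∀ i, |ev i| ≤ frobeniusNorm M := abs_eigenvalues_le_frobeniusNorm hM
  have sum_sq : frobeniusNorm M ^ 2 = ∑ i, ev i ^ 2 := by
    rw [frobeniusNorm_sq hM, trace_mul_self_eq_sum_eigenvalues_sq hM]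
  have log_det : Real.log (1 + M).det = ∑ i, Real.log (1 + ev i) := by
    rw [det_one_add_eq_prod_eigenvalues hM,
      Real.log_prod fun i _ => (one_add_eigenvalues_pos hM (by linarith) i).ne']
  have trace_eq : M.trace = ∑ i, ev i := hM.trace_eq_sum_eigenvalues
  calc |Real.log (1 + M).det - M.trace + frobeniusNorm M ^ 2 / 2|
      = |∑ i, (Real.log (1 + ev i) - ev i + ev i ^ 2 / 2)| := by
        rw [log_det, trace_eq, sum_sq, Finset.sum_add_distrib, Finset.sum_sub_distrib,
          Finset.sum_div]
    _ ≤ ∑ i, 2 * |ev i| ^ 3 := (Finset.abs_sum_le_sum_abs _ _).trans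
        (Finset.sum_le_sum fun i _ => abs_log_one_add_sub_le ((ev_le i).trans hM'))
    _ ≤ ∑ i, 2 * frobeniusNorm M * ev i ^ 2 := by
        refine Finset.sum_le_sum fun i _ => ?_
        rw [pow_succ, sq_abs]
        nlinarith [mul_le_mul_of_nonneg_left (ev_le i) (sq_nonneg (ev i))]
    _ = 2 * frobeniusNorm M ^ 3 := by
        rw [← Finset.mul_sum, ← sum_sq]
        ring

end LogDet

section WeightedNorm

open scoped MatrixOrder

variable {p : ℕ} {M S T Φ : Matrix (Fin p) (Fin p) ℝ}

lemma sqrt_isHermitian (S : Matrix (Fin p) (Fin p) ℝ) : (CFC.sqrt S).IsHermitian :=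
  (Matrix.nonneg_iff_posSemidef.1 (CFC.sqrt_nonneg S)).isHermitian

lemma isUnit_sqrt (hS : S.PosDef) : IsUnit (CFC.sqrt S) :=
  (CFC.isUnit_sqrt_iff S hS.posSemidef.nonneg).2 hS.isUnit

lemma isHermitian_sqrt_mul_mul_sqrt (S : Matrix (Fin p) (Fin p) ℝ) (hΦ : Φ.IsHermitian) :
    (CFC.sqrt S * Φ * CFC.sqrt S).IsHermitian := by
  simpa only [(sqrt_isHermitian S).eq] using
    Matrix.isHermitian_mul_mul_conjTranspose (CFC.sqrt S) hΦ

lemma trace_mul_nonneg (hS : 0 ≤ S) (hT : 0 ≤ T) : 0 ≤ (S * T).trace := by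
  rw [← CFC.sqrt_mul_sqrt_self S hS, Matrix.mul_assoc, Matrix.trace_mul_comm]
  have := ((Matrix.nonneg_iff_posSemidef.1 hT).mul_mul_conjTranspose_same
    (CFC.sqrt S)).trace_nonneg
  rwa [(sqrt_isHermitian S).eq] at this

lemma weightedNorm_nonneg (S Φ : Matrix (Fin p) (Fin p) ℝ) : 0 ≤ weightedNorm S Φ :=
  frobeniusNorm_nonneg _

lemma weightedNorm_pos (hS : S.PosDef) (hΦ : Φ ≠ 0) : 0 < weightedNorm S Φ := by
  refine (weightedNorm_nonneg S Φ).lt_of_ne fun h => hΦ ?_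
  have conj_zero := frobeniusNorm_eq_zero_iff.1 h.symm
  rwa [(isUnit_sqrt hS).mul_left_eq_zero, (isUnit_sqrt hS).mul_right_eq_zero] at conj_zero

lemma weightedNorm_smul (c : ℝ) (S Φ : Matrix (Fin p) (Fin p) ℝ) :
    weightedNorm S (c • Φ) = |c| * weightedNorm S Φ := by
  rw [weightedNorm, Matrix.mul_smul, Matrix.smul_mul, frobeniusNorm_smul, weightedNorm]

lemma weightedNorm_sq (hS : 0 ≤ S) (hΦ : Φ.IsHermitian) :
    weightedNorm S Φ ^ 2 = (S * (Φ * S * Φ)).trace := by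
  have sqrt_sq := CFC.sqrt_mul_sqrt_self S hS
  rw [weightedNorm, frobeniusNorm_sq (isHermitian_sqrt_mul_mul_sqrt S hΦ)]
  conv_rhs => rw [← sqrt_sq, Matrix.mul_assoc, Matrix.trace_mul_comm]
  simp only [Matrix.mul_assoc]

lemma weightedNorm_smul_left {c : ℝ} (hc : 0 ≤ c) (hS : 0 ≤ S) (hΦ : Φ.IsHermitian) :
    weightedNorm (c • S) Φ = c * weightedNorm S Φ := by
  rw [← sq_eq_sq₀ (weightedNorm_nonneg _ _) (mul_nonneg hc (weightedNorm_nonneg _ _)), mul_pow,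
    weightedNorm_sq (smul_nonneg hc hS) hΦ, weightedNorm_sq hS hΦ]
  simp only [Matrix.mul_smul, Matrix.smul_mul, Matrix.trace_smul, smul_eq_mul]
  ring

lemma weightedNorm_mono (hS : 0 ≤ S) (hST : S ≤ T) (hΦ : Φ.IsHermitian) :
    weightedNorm S Φ ≤ weightedNorm T Φ := by
  have conj_nonneg {U : Matrix (Fin p) (Fin p) ℝ} (hU : 0 ≤ U) : 0 ≤ Φ * U * Φ := by
    simpa only [hΦ.eq] using
      ((Matrix.nonneg_iff_posSemidef.1 hU).mul_mul_conjTranspose_same Φ).nonneg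
  have hT := hS.trans hST
  have left_step := trace_mul_nonneg (sub_nonneg.2 hST) (conj_nonneg hT)
  have right_step := trace_mul_nonneg hS (conj_nonneg (sub_nonneg.2 hST))
  refine le_of_sq_le_sq ?_ (weightedNorm_nonneg T Φ)
  rw [weightedNorm_sq hS hΦ, weightedNorm_sq hT hΦ]
  simp only [Matrix.sub_mul, Matrix.mul_sub, Matrix.trace_sub] at left_step right_step
  linarith

lemma le_specNorm_smul_one (hM : M.IsHermitian) : M ≤ specNorm M • 1 := by
  have hermitian : (specNorm M • (1 : Matrix (Fin p) (Fin p) ℝ) - M).IsHermitian :=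
    (Matrix.isHermitian_one.smul (IsSelfAdjoint.all _)).sub hM
  refine Matrix.le_iff.2 (.of_dotProduct_mulVec_nonneg hermitian fun v => ?_)
  set u := WithLp.toLp 2 v
  have norm_sq : v ⬝ᵥ v = ‖u‖ * ‖u‖ := by
    rw [← real_inner_self_eq_norm_mul_norm, EuclideanSpace.inner_toLp_toLp, star_trivial]
  have quadratic_form : v ⬝ᵥ M.mulVec v = inner ℝ u (Matrix.toEuclideanCLM (𝕜 := ℝ) M u) := by
    rw [Matrix.toEuclideanCLM_toLp, EuclideanSpace.inner_toLp_toLp, star_trivial, dotProduct_comm]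
  have bound := (real_inner_le_norm u _).trans
    (mul_le_mul_of_nonneg_left ((Matrix.toEuclideanCLM (𝕜 := ℝ) M).le_opNorm u) (norm_nonneg u))
  rw [star_trivial, Matrix.sub_mulVec, Matrix.smul_mulVec, Matrix.one_mulVec, dotProduct_sub,
    dotProduct_smul, smul_eq_mul, norm_sq, quadratic_form, specNorm]
  linarith

lemma one_le_specNorm_inv_smul (hS : S.PosDef) : 1 ≤ specNorm S⁻¹ • S := by
  have sqrt_sq := CFC.sqrt_mul_sqrt_self S hS.posSemidef.nonneg
  have sqrt_unit : IsUnit (CFC.sqrt S).det :=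
    (Matrix.isUnit_iff_isUnit_det _).1 (isUnit_sqrt hS)
  have conj_inv : CFC.sqrt S * S⁻¹ * CFC.sqrt S = 1 := by
    have inv_eq : S⁻¹ = (CFC.sqrt S)⁻¹ * (CFC.sqrt S)⁻¹ := by rw [← Matrix.mul_inv_rev, sqrt_sq]
    rw [inv_eq, Matrix.mul_nonsing_inv_cancel_left _ _ sqrt_unit,
      Matrix.nonsing_inv_mul _ sqrt_unit]
  have := IsSelfAdjoint.conjugate_le_conjugate (le_specNorm_smul_one hS.inv.isHermitian)
    (sqrt_isHermitian S)
  simpa only [conj_inv, Matrix.mul_smul, Matrix.smul_mul, Matrix.mul_one, sqrt_sq] using this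

lemma specNorm_neg (M : Matrix (Fin p) (Fin p) ℝ) : specNorm (-M) = specNorm M := by
  rw [specNorm, map_neg, norm_neg, specNorm]

lemma le_smul_of_specNorm_mul_specNorm_inv_le (hS : S.PosDef) (hM : M.IsHermitian) {e : ℝ}
    (he : specNorm M * specNorm S⁻¹ ≤ e) : M ≤ e • S :=
  calc M ≤ specNorm M • 1 := le_specNorm_smul_one hM
    _ ≤ specNorm M • specNorm S⁻¹ • S :=
        smul_le_smul_of_nonneg_left (one_le_specNorm_inv_smul hS) (norm_nonneg _)
    _ = (specNorm M * specNorm S⁻¹) • S := smul_smul _ _ _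
    _ ≤ e • S := smul_le_smul_of_nonneg_right he hS.posSemidef.nonneg

lemma abs_weightedNorm_sub_le (hS : S.PosDef) (hT : T.PosDef) (hΦ : Φ.IsHermitian) {e : ℝ}
    (he : specNorm (T - S) * specNorm S⁻¹ ≤ e) :
    |weightedNorm T Φ - weightedNorm S Φ| ≤ e * weightedNorm S Φ := by
  have he0 : 0 ≤ e := (mul_nonneg (norm_nonneg _) (norm_nonneg _)).trans he
  have hS0 := hS.posSemidef.nonneg
  have hT0 := hT.posSemidef.nonneg
  have diff := hT.isHermitian.sub hS.isHermitian
  have upper : T ≤ (1 + e) • S := by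
    have := le_smul_of_specNorm_mul_specNorm_inv_le hS diff he
    rw [add_smul, one_smul]
    exact sub_le_iff_le_add'.1 this
  have lower : (1 - e) • S ≤ T := by
    have := le_smul_of_specNorm_mul_specNorm_inv_le (e := e) hS diff.neg (by rwa [specNorm_neg])
    rw [sub_smul, one_smul, sub_le_iff_le_add, ← sub_le_iff_le_add']
    rwa [neg_sub] at this
  have upper_norm := weightedNorm_mono hT0 upper hΦ
  rw [weightedNorm_smul_left (by linarith) hS0 hΦ] at upper_norm
  have lower_norm : (1 - e) * weightedNorm S Φ ≤ weightedNorm T Φ := by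
    rcases le_total e 1 with he1 | he1
    · rw [← weightedNorm_smul_left (sub_nonneg.2 he1) hS0 hΦ]
      exact weightedNorm_mono (smul_nonneg (sub_nonneg.2 he1) hS0) lower hΦ
    · exact (mul_nonpos_of_nonpos_of_nonneg (sub_nonpos.2 he1) (weightedNorm_nonneg _ _)).trans
        (weightedNorm_nonneg _ _)
  rw [abs_le]
  constructor <;> linarith

end WeightedNorm

section MomentConvergence

open scoped NNReal

lemma lintegral_eq_iSup_lintegral_min {X : Type*} [MeasurableSpace X] (μ : Measure X)
    {f : X → ℝ≥0} (hf : Measurable f) :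
    ∫⁻ x, f x ∂μ = ⨆ k : ℕ, ∫⁻ x, (min (f x) k : ℝ≥0) ∂μ := by
  rw [← lintegral_iSup fun k => (hf.min measurable_const).coe_nnreal_ennreal]
  · refine lintegral_congr fun x => le_antisymm ?_
      (iSup_le fun k => by gcongr; exact min_le_left _ _)
    obtain ⟨k, hk⟩ := exists_nat_ge (f x)
    exact le_iSup_of_le k (by rw [min_eq_left hk])
  · exact fun j k hjk x => ENNReal.coe_le_coe.2 (min_le_min le_rfl (Nat.cast_le.2 hjk))

lemma le_min_add_inv_mul_sq (a : ℝ≥0) {L : ℝ≥0} (hL : L ≠ 0) : a ≤ min a L + L⁻¹ * a ^ 2 := by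
  rcases le_total a L with h | h
  · rw [min_eq_left h]
    exact le_self_add
  · calc a = L⁻¹ * (L * a) := (inv_mul_cancel_left₀ hL a).symm
      _ ≤ L⁻¹ * a ^ 2 := by rw [sq]; gcongr
      _ ≤ _ := le_add_self

lemma lintegral_le_lintegral_min_add {X : Type*} [MeasurableSpace X] (μ : Measure X)
    {f : X → ℝ≥0} (hf : Measurable f) {L : ℝ≥0}
    (hL : L ≠ 0) : ∫⁻ x, f x ∂μ ≤
      ∫⁻ x, (min (f x) L : ℝ≥0) ∂μ + (L : ℝ≥0∞)⁻¹ * ∫⁻ x, (f x : ℝ≥0∞) ^ 2 ∂μ := by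
  rw [← lintegral_const_mul _ (by fun_prop), ← lintegral_add_right _ (by fun_prop)]
  refine lintegral_mono fun x => ?_
  rw [← ENNReal.coe_inv hL, ← ENNReal.coe_pow, ← ENNReal.coe_mul, ← ENNReal.coe_add]
  exact ENNReal.coe_le_coe.2 (le_min_add_inv_mul_sq (f x) hL)

section Truncation

variable {ι X : Type*} {l : Filter ι} [TopologicalSpace X] [MeasurableSpace X]
  [OpensMeasurableSpace X]

lemma tendsto_lintegral_min {μ : ι → ProbabilityMeasure X} {ν : ProbabilityMeasure X}
    (hμ : Tendsto μ l (𝓝 ν)) {f : X → ℝ≥0} (hf : Continuous f) (L : ℝ≥0) :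
    Tendsto (fun i => ∫⁻ x, (min (f x) L : ℝ≥0) ∂(μ i : Measure X)) l
      (𝓝 (∫⁻ x, (min (f x) L : ℝ≥0) ∂(ν : Measure X))) := by
  have dist_le (x y : X) : dist (min (f x) L) (min (f y) L) ≤ L := by
    have hx : ((min (f x) L : ℝ≥0) : ℝ) ≤ L := NNReal.coe_le_coe.2 (min_le_right _ _)
    have hy : ((min (f y) L : ℝ≥0) : ℝ) ≤ L := NNReal.coe_le_coe.2 (min_le_right _ _)
    rw [NNReal.dist_eq, abs_sub_le_iff]
    constructor <;> linarith [NNReal.coe_nonneg (min (f x) L), NNReal.coe_nonneg (min (f y) L)]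
  exact ProbabilityMeasure.tendsto_iff_forall_lintegral_tendsto.1 hμ
    (.mkOfBound ⟨fun x => min (f x) L, hf.min continuous_const⟩ L dist_le)

lemma tendsto_lintegral_of_lintegral_sq_le {μ : ι → ProbabilityMeasure X}
    {ν : ProbabilityMeasure X} (hμ : Tendsto μ l (𝓝 ν)) {f : X → ℝ≥0} (hf : Continuous f)
    {C : ℝ≥0∞} (hC : C ≠ ∞) (hsq : ∀ᶠ i in l, ∫⁻ x, (f x : ℝ≥0∞) ^ 2 ∂(μ i : Measure X) ≤ C) :
    Tendsto (fun i => ∫⁻ x, f x ∂(μ i : Measure X)) l (𝓝 (∫⁻ x, f x ∂(ν : Measure X))) := by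
  have min_le (L : ℝ≥0) (ρ : Measure X) : ∫⁻ x, (min (f x) L : ℝ≥0) ∂ρ ≤ ∫⁻ x, f x ∂ρ :=
    lintegral_mono fun x => by gcongr; exact min_le_left _ _
  refine tendsto_order.2 ⟨fun a ha => ?_, fun b hb => ?_⟩
  · rw [lintegral_eq_iSup_lintegral_min _ hf.measurable] at ha
    obtain ⟨k, hk⟩ := lt_iSup_iff.1 ha
    filter_upwards [(tendsto_lintegral_min hμ hf k).eventually_const_lt hk] with i hi
    exact hi.trans_le (min_le k _)
  · have tail : Tendsto (fun k : ℕ => ∫⁻ x, f x ∂(ν : Measure X) + (k : ℝ≥0∞)⁻¹ * C) atTop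
        (𝓝 (∫⁻ x, f x ∂(ν : Measure X))) := by
      simpa using tendsto_const_nhds.add
        (ENNReal.Tendsto.mul_const ENNReal.tendsto_inv_nat_nhds_zero (.inr hC))
    obtain ⟨k, hkb, hk0⟩ := ((tail.eventually_lt_const hb).and (eventually_ne_atTop 0)).exists
    have truncated := (tendsto_lintegral_min hμ hf k).add_const ((k : ℝ≥0∞)⁻¹ * C)
    have limit_lt := (add_le_add_left (min_le k _) _).trans_lt hkb
    filter_upwards [truncated.eventually_lt_const limit_lt, hsq] with i hi hsq_i
    refine (lintegral_le_lintegral_min_add _ hf.measurable (Nat.cast_ne_zero.2 hk0)).trans_lt ?_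
    refine lt_of_le_of_lt ?_ hi
    rw [ENNReal.coe_natCast]
    gcongr

end Truncation

lemma isTightMeasureSet_of_lintegral_le {X : Type*} [TopologicalSpace X] [MeasurableSpace X]
    {S : Set (Measure X)} {f : X → ℝ≥0∞} (hf : Measurable f)
    (hcompact : ∀ r : ℝ≥0, IsCompact {x | f x ≤ r}) {C : ℝ≥0∞} (hC : C ≠ ∞)
    (hS : ∀ μ ∈ S, ∫⁻ x, f x ∂μ ≤ C) : IsTightMeasureSet S := by
  refine isTightMeasureSet_iff_exists_isCompact_measure_compl_le.2 fun ε hε => ?_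
  obtain ⟨r, hr0, hr⟩ : ∃ r : ℝ≥0, (r : ℝ≥0∞) ≠ 0 ∧ C / r ≤ ε := by
    have quotient : Tendsto (fun k : ℕ => C * (k : ℝ≥0∞)⁻¹) atTop (𝓝 0) := by
      simpa using ENNReal.Tendsto.const_mul ENNReal.tendsto_inv_nat_nhds_zero (.inr hC)
    obtain ⟨k, hk, hk0⟩ := ((quotient.eventually_lt_const hε).and (eventually_ne_atTop 0)).exists
    exact ⟨k, by simpa using hk0, by simpa [div_eq_mul_inv] using hk.le⟩
  refine ⟨_, hcompact r, fun μ hμ => ?_⟩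
  calc μ {x | f x ≤ r}ᶜ ≤ μ {x | (r : ℝ≥0∞) ≤ f x} :=
        measure_mono fun x (hx : ¬ f x ≤ r) => (not_le.1 hx).le
    _ ≤ (∫⁻ x, f x ∂μ) / r := meas_ge_le_lintegral_div hf.aemeasurable hr0 ENNReal.coe_ne_top
    _ ≤ C / r := by gcongr; exact hS μ hμ
    _ ≤ ε := hr

/-- The function `x ↦ e^{tx}` with values in `ℝ≥0`, the form in which exponential moments are
Lebesgue integrals. -/
noncomputable def nnrealExp (t x : ℝ) : ℝ≥0 := (Real.exp (t * x)).toNNReal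

lemma continuous_nnrealExp (t : ℝ) : Continuous (nnrealExp t) := by
  unfold nnrealExp
  fun_prop

lemma nnrealExp_sq (t x : ℝ) : nnrealExp t x ^ 2 = nnrealExp (2 * t) x := by
  rw [nnrealExp, ← Real.toNNReal_pow (Real.exp_pos _).le, ← Real.exp_nat_mul, nnrealExp]
  push_cast
  ring_nf

lemma isCompact_nnrealExp_add_le (r : ℝ≥0) :
    IsCompact {x : ℝ | (nnrealExp 1 x + nnrealExp (-1) x : ℝ≥0∞) ≤ r} := by
  refine (isCompact_Icc (a := -(r : ℝ)) (b := r)).of_isClosed_subset ?_ fun x hx => ?_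
  · have h1 := continuous_nnrealExp 1
    have h2 := continuous_nnrealExp (-1)
    exact isClosed_le (by fun_prop) continuous_const
  · have sum_le : Real.exp (1 * x) + Real.exp (-1 * x) ≤ r := by
      rw [Set.mem_ofPred_eq, ← ENNReal.coe_add, ENNReal.coe_le_coe, ← NNReal.coe_le_coe] at hx
      simpa [nnrealExp, (Real.exp_pos _).le] using hx
    rw [Set.mem_Icc]
    constructor <;> linarith [Real.add_one_le_exp (1 * x), Real.add_one_le_exp (-1 * x),
      Real.exp_pos (1 * x), Real.exp_pos (-1 * x)]

lemma lintegral_nnrealExp {μ : Measure ℝ} {t : ℝ} (h : Integrable (fun x => Real.exp (t * x)) μ) :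
    ∫⁻ x, nnrealExp t x ∂μ = ENNReal.ofReal (mgf id μ t) :=
  (ofReal_integral_eq_lintegral_ofReal h (.of_forall fun _ => (Real.exp_pos _).le)).symm

lemma eq_of_mgf_id_eq {μ ν : Measure ℝ} [IsProbabilityMeasure μ] [IsFiniteMeasure ν]
    (hμ : ∀ t, Integrable (fun x => Real.exp (t * x)) μ) (h : mgf id μ = mgf id ν) : μ = ν := by
  refine Measure.ext_of_complexMGF_id_eq (funext fun z => eqOn_complexMGF_of_mgf h ?_)
  have univ_set : integrableExpSet id μ = Set.univ := Set.eq_univ_of_forall hμ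
  simp [univ_set]

variable {ι : Type*} {l : Filter ι} {μ : ι → ProbabilityMeasure ℝ} {γ : ProbabilityMeasure ℝ}

lemma tendsto_lintegral_nnrealExp (hγ : ∀ t, Integrable (fun x => Real.exp (t * x)) (γ : Measure ℝ))
    (h : ∀ t, Tendsto (fun i => mgf id (μ i : Measure ℝ) t) l (𝓝 (mgf id (γ : Measure ℝ) t)))
    (t : ℝ) : Tendsto (fun i => ∫⁻ x, nnrealExp t x ∂(μ i : Measure ℝ)) l
      (𝓝 (∫⁻ x, nnrealExp t x ∂(γ : Measure ℝ))) := by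
  rw [lintegral_nnrealExp (hγ t)]
  refine (ENNReal.tendsto_ofReal (h t)).congr' ?_
  filter_upwards [(h t).eventually_const_lt (mgf_pos (hγ t))] with i hi
  exact (lintegral_nnrealExp (mgf_pos_iff.1 hi)).symm

lemma exists_tendsto_of_tendsto_lintegral_nnrealExp (u : Ultrafilter ι)
    (h : ∀ t, Tendsto (fun i => ∫⁻ x, nnrealExp t x ∂(μ i : Measure ℝ)) u
      (𝓝 (∫⁻ x, nnrealExp t x ∂(γ : Measure ℝ))))
    (hγ : ∀ t, ∫⁻ x, nnrealExp t x ∂(γ : Measure ℝ) ≠ ∞) :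
    ∃ ν, Tendsto μ u (𝓝 ν) := by
  set V : ℝ → ℝ≥0∞ := fun x => nnrealExp 1 x + nnrealExp (-1) x
  have hV : Measurable V := by
    have h1 := (continuous_nnrealExp 1).measurable
    have h2 := (continuous_nnrealExp (-1)).measurable
    fun_prop
  have lintegral_V (ρ : Measure ℝ) : ∫⁻ x, V x ∂ρ =
      ∫⁻ x, nnrealExp 1 x ∂ρ + ∫⁻ x, nnrealExp (-1) x ∂ρ :=
    lintegral_add_left (continuous_nnrealExp 1).measurable.coe_nnreal_ennreal _
  obtain ⟨C, hC, hC_top⟩ : ∃ C, ∫⁻ x, V x ∂(γ : Measure ℝ) < C ∧ C < ∞ := by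
    apply exists_between
    rw [lintegral_V]
    exact (ENNReal.add_ne_top.2 ⟨hγ 1, hγ (-1)⟩).lt_top
  have bounded : ∀ᶠ i in (u : Filter ι), ∫⁻ x, V x ∂(μ i : Measure ℝ) ≤ C := by
    rw [lintegral_V] at hC
    simp only [lintegral_V]
    exact (((h 1).add (h (-1))).eventually_lt_const hC).mono fun i hi => hi.le
  have compact : IsCompact (closure {ρ : ProbabilityMeasure ℝ | ∫⁻ x, V x ∂(ρ : Measure ℝ) ≤ C}) :=
    isCompact_closure_of_isTightMeasureSet <| isTightMeasureSet_of_lintegral_le hV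
      isCompact_nnrealExp_add_le hC_top.ne (by rintro _ ⟨ρ, hρ, rfl⟩; exact hρ)
  obtain ⟨ν, -, hν⟩ := compact.ultrafilter_le_nhds (u.map μ)
    (le_principal_iff.2 (bounded.mono fun i hi => subset_closure hi))
  exact ⟨ν, hν⟩

theorem tendsto_of_tendsto_mgf
    (hγ : ∀ t, Integrable (fun x => Real.exp (t * x)) (γ : Measure ℝ))
    (h : ∀ t, Tendsto (fun i => mgf id (μ i : Measure ℝ) t) l (𝓝 (mgf id (γ : Measure ℝ) t))) :
    Tendsto μ l (𝓝 γ) := by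
  refine (tendsto_iff_ultrafilter _ _ _).2 fun u hu => ?_
  have moments := tendsto_lintegral_nnrealExp hγ fun t => (h t).mono_left hu
  have finite (t : ℝ) : ∫⁻ x, nnrealExp t x ∂(γ : Measure ℝ) ≠ ∞ := by
    rw [lintegral_nnrealExp (hγ t)]
    exact ENNReal.ofReal_ne_top
  obtain ⟨ν, hν⟩ := exists_tendsto_of_tendsto_lintegral_nnrealExp u moments finite
  have moments_eq (t : ℝ) :
      ∫⁻ x, nnrealExp t x ∂(ν : Measure ℝ) = ∫⁻ x, nnrealExp t x ∂(γ : Measure ℝ) := by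
    obtain ⟨C, hC, hC_top⟩ := exists_between (finite (2 * t)).lt_top
    refine tendsto_nhds_unique (tendsto_lintegral_of_lintegral_sq_le hν
      (continuous_nnrealExp t) hC_top.ne ?_) (moments t)
    filter_upwards [(moments (2 * t)).eventually_lt_const hC] with i hi
    refine le_of_eq_of_le (lintegral_congr fun x => ?_) hi.le
    exact_mod_cast nnrealExp_sq t x
  have integrable (t : ℝ) : Integrable (fun x => Real.exp (t * x)) (ν : Measure ℝ) := by
    refine ⟨by fun_prop, ?_⟩
    rw [hasFiniteIntegral_iff_ofReal (.of_forall fun _ => (Real.exp_pos _).le)]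
    exact (moments_eq t ▸ finite t).lt_top
  have mgf_eq : mgf id (ν : Measure ℝ) = mgf id (γ : Measure ℝ) := by
    ext t
    have := moments_eq t
    rwa [lintegral_nnrealExp (integrable t), lintegral_nnrealExp (hγ t),
      ENNReal.ofReal_eq_ofReal_iff mgf_nonneg mgf_nonneg] at this
  have ν_eq : ν = γ := ProbabilityMeasure.toMeasure_injective (eq_of_mgf_id_eq integrable mgf_eq)
  rwa [ν_eq] at hν

end MomentConvergence

section DistributionFunction

variable {ι : Type*} {l : Filter ι}

lemma tendstoUniformly_of_monotone_of_Ioo_subset_range {α : Type*} [LinearOrder α]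
    {F : ι → α → ℝ} {G : α → ℝ} (hF : ∀ i, Monotone (F i)) (hF_mem : ∀ i t, F i t ∈ Set.Icc 0 1)
    (hG : Monotone G) (hG_mem : ∀ t, G t ∈ Set.Icc 0 1) (hG_range : Set.Ioo 0 1 ⊆ Set.range G)
    (h : ∀ t, Tendsto (fun i => F i t) l (𝓝 (G t))) : TendstoUniformly F G l := by
  rw [tendstoUniformly_iff_tendsto, tendsto_iff_ultrafilter]
  intro u hu
  have hu_fst : Tendsto Prod.fst (u : Filter (ι × α)) l := tendsto_fst.mono_left hu
  obtain ⟨c, hc_mem, hc⟩ := isCompact_Icc.ultrafilter_le_nhds (u.map fun q : ι × α => G q.2)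
    (tendsto_principal.2 (.of_forall fun q : ι × α => hG_mem q.2))
  obtain ⟨d, hd_mem, hd⟩ := isCompact_Icc.ultrafilter_le_nhds (u.map fun q : ι × α => F q.1 q.2)
    (tendsto_principal.2 (.of_forall fun q : ι × α => hF_mem q.1 q.2))
  change Tendsto (fun q : ι × α => G q.2) u (𝓝 c) at hc
  change Tendsto (fun q : ι × α => F q.1 q.2) u (𝓝 d) at hd
  -- A value `G x` strictly between `c` and `d` would put almost all `q.2` on one side of `x`.
  have hd_le : d ≤ c := by
    by_contra! hcd
    obtain ⟨v, hcv, hvd⟩ := exists_between hcd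
    obtain ⟨x, rfl⟩ := hG_range ⟨hc_mem.1.trans_lt hcv, hvd.trans_le hd_mem.2⟩
    refine hvd.not_ge (le_of_tendsto_of_tendsto hd ((h x).comp hu_fst) ?_)
    filter_upwards [hc.eventually_lt_const hcv] with q hq
    exact hF q.1 (hG.reflect_lt hq).le
  have hle_d : c ≤ d := by
    by_contra! hdc
    obtain ⟨v, hdv, hvc⟩ := exists_between hdc
    obtain ⟨x, rfl⟩ := hG_range ⟨hd_mem.1.trans_lt hdv, hvc.trans_le hc_mem.2⟩
    refine hdv.not_ge (le_of_tendsto_of_tendsto ((h x).comp hu_fst) hd ?_)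
    filter_upwards [hc.eventually_const_lt hvc] with q hq
    exact hF q.1 (hG.reflect_lt hq).le
  rw [le_antisymm hd_le hle_d] at hd
  exact (hc.prodMk_nhds hd).mono_right (nhds_le_uniformity c)

lemma continuous_cdf (γ : Measure ℝ) [IsProbabilityMeasure γ] [NullSingletonClass γ] :
    Continuous (cdf γ) := by
  refine continuous_iff_continuousAt.2 fun x => ?_
  rw [(monotone_cdf γ).continuousAt_iff_leftLim_eq_rightLim, StieltjesFunction.rightLim_eq]
  have no_jump := (cdf γ).measure_singleton x
  rw [measure_cdf, measure_singleton, eq_comm, ENNReal.ofReal_eq_zero, sub_nonpos] at no_jump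
  exact ((monotone_cdf γ).leftLim_le le_rfl).antisymm no_jump

lemma Ioo_subset_range_cdf (γ : Measure ℝ) [IsProbabilityMeasure γ] [NullSingletonClass γ] :
    Set.Ioo 0 1 ⊆ Set.range (cdf γ) := fun v hv => by
  obtain ⟨a, ha⟩ := ((tendsto_cdf_atBot γ).eventually_le_const hv.1).exists
  obtain ⟨b, hb⟩ := ((tendsto_cdf_atTop γ).eventually_const_le hv.2).exists
  exact mem_range_of_exists_le_of_exists_ge (continuous_cdf γ) ⟨a, ha⟩ ⟨b, hb⟩

theorem tendstoUniformly_cdf_of_tendsto {μ : ι → ProbabilityMeasure ℝ} {γ : ProbabilityMeasure ℝ}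
    [NullSingletonClass (γ : Measure ℝ)] (h : Tendsto μ l (𝓝 γ)) :
    TendstoUniformly (fun i => cdf (μ i : Measure ℝ)) (cdf (γ : Measure ℝ)) l := by
  refine tendstoUniformly_of_monotone_of_Ioo_subset_range (fun i => monotone_cdf _)
    (fun i t => ⟨cdf_nonneg _ t, cdf_le_one _ t⟩) (monotone_cdf _)
    (fun t => ⟨cdf_nonneg _ t, cdf_le_one _ t⟩) (Ioo_subset_range_cdf _) fun t => ?_
  have frontier_null : (γ : Measure ℝ) (frontier (Set.Iic t)) = 0 := by
    rw [frontier_Iic, measure_singleton]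
  simp only [cdf_eq_real]
  exact (ENNReal.tendsto_toReal (measure_ne_top _ _)).comp
    (ProbabilityMeasure.tendsto_measure_of_null_frontier_of_tendsto' h frontier_null)

lemma tendsto_iSup_ofReal_abs_sub {α : Type*} {F : ι → α → ℝ} {G : α → ℝ}
    (h : TendstoUniformly F G l) :
    Tendsto (fun i => ⨆ t, ENNReal.ofReal |F i t - G t|) l (𝓝 0) := by
  refine ENNReal.tendsto_nhds_zero.2 fun ε hε => ?_
  obtain ⟨r, hr0, hrε⟩ : ∃ r : ℝ, 0 < r ∧ ENNReal.ofReal r ≤ ε := by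
    obtain ⟨r, hr0, hrε⟩ := ENNReal.lt_iff_exists_nnreal_btwn.1 hε
    exact ⟨r, by exact_mod_cast hr0, by simpa using hrε.le⟩
  filter_upwards [Metric.tendstoUniformly_iff.1 h r hr0] with i hi
  refine iSup_le fun t => (ENNReal.ofReal_le_ofReal ?_).trans hrε
  rw [abs_sub_comm]
  exact (hi t).le

end DistributionFunction

section HighProbability

/-- The filter on the disjoint union of a sequence of probability spaces whose elements are the
events with probability tending to one. Convergence to `0` along this filter is `o_P(1)`, so
stochastic limits become limits along a filter. -/
def highProb {E : ℕ → Type*} [∀ n, MeasurableSpace (E n)] (P : ∀ n, Measure (E n)) :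
    Filter (Σ n, E n) where
  sets := {G | Tendsto (fun n => P n {x | (⟨n, x⟩ : Σ n, E n) ∉ G}) atTop (𝓝 0)}
  univ_sets := by simp
  sets_of_superset hG hGH := tendsto_of_tendsto_of_tendsto_of_le_of_le tendsto_const_nhds hG
    (fun _ => zero_le) fun _ => measure_mono fun _ hx hxG => hx (hGH hxG)
  inter_sets {G H} hG hH := by
    refine tendsto_of_tendsto_of_tendsto_of_le_of_le tendsto_const_nhds
      (by simpa using hG.add hH) (fun _ => zero_le) fun n => ?_
    refine (measure_mono fun x hx => ?_).trans (measure_union_le _ _)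
    exact not_and_or.1 hx

variable {E : ℕ → Type*} [∀ n, MeasurableSpace (E n)] {P : ∀ n, Measure (E n)}

lemma eventually_highProb {q : (Σ n, E n) → Prop} :
    (∀ᶠ i in highProb P, q i) ↔ Tendsto (fun n => P n {x | ¬ q ⟨n, x⟩}) atTop (𝓝 0) :=
  Iff.rfl

lemma isLittleOP_iff_tendsto_highProb {Y : ∀ n, E n → ℝ≥0∞} :
    IsLittleOP P Y ↔ Tendsto (fun i : Σ n, E n => Y i.1 i.2) (highProb P) (𝓝 0) := by
  rw [← bot_eq_zero, nhds_bot_basis.tendsto_right_iff]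
  simp only [IsLittleOP, eventually_highProb, Set.mem_Iio, not_lt, bot_eq_zero]

lemma isLittleOP_ofReal_abs_sub_iff {Y : ∀ n, E n → ℝ} {a : ℝ} :
    IsLittleOP P (fun n x => ENNReal.ofReal |Y n x - a|) ↔
      Tendsto (fun i : Σ n, E n => Y i.1 i.2) (highProb P) (𝓝 a) := by
  rw [isLittleOP_iff_tendsto_highProb, tendsto_iff_edist_tendsto_0]
  simp only [edist_dist, Real.dist_eq]

lemma tendsto_fst_highProb : Tendsto Sigma.fst (highProb P) atTop := by
  refine tendsto_atTop.2 fun N => ?_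
  refine eventually_highProb.2 (tendsto_const_nhds.congr' ?_)
  filter_upwards [eventually_ge_atTop N] with n hn
  simp [hn]

end HighProbability

section LikelihoodExpansion

open scoped MatrixOrder

variable {n p : ℕ} {Ω Ψ S Φ : Matrix (Fin p) (Fin p) ℝ}

lemma det_add_eq_det_mul (hΩ : Ω.PosDef) (Ψ : Matrix (Fin p) (Fin p) ℝ) :
    (Ω + Ψ).det = Ω.det * (1 + CFC.sqrt Ω⁻¹ * Ψ * CFC.sqrt Ω⁻¹).det := by
  have sqrt_sq := CFC.sqrt_mul_sqrt_self Ω⁻¹ hΩ.inv.posSemidef.nonneg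
  have factor : Ω + Ψ = Ω * (1 + Ω⁻¹ * Ψ) := by
    rw [Matrix.mul_add, Matrix.mul_one,
      Matrix.mul_nonsing_inv_cancel_left _ _ (isUnit_iff_ne_zero.2 hΩ.det_pos.ne')]
  rw [factor, Matrix.det_mul, Matrix.det_one_add_mul_comm (CFC.sqrt Ω⁻¹ * Ψ), ← Matrix.mul_assoc,
    sqrt_sq]

lemma trace_sqrt_mul_mul_sqrt (hS : 0 ≤ S) (Φ : Matrix (Fin p) (Fin p) ℝ) :
    (CFC.sqrt S * Φ * CFC.sqrt S).trace = (S * Φ).trace := by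
  rw [Matrix.trace_mul_comm, ← Matrix.mul_assoc, CFC.sqrt_mul_sqrt_self S hS]

lemma abs_logLik_add_sub_le (x : Sample n p) (hΩ : Ω.PosDef) (hΨ : Ψ.IsHermitian)
    (hΨ_le : weightedNorm Ω⁻¹ Ψ ≤ 1 / 2) :
    |logLik x (Ω + Ψ) - logLik x Ω - (n / 2 * ((Ω⁻¹ - sampleCov x) * Ψ).trace
      - n / 4 * weightedNorm Ω⁻¹ Ψ ^ 2)| ≤ n * weightedNorm Ω⁻¹ Ψ ^ 3 := by
  set M := CFC.sqrt Ω⁻¹ * Ψ * CFC.sqrt Ω⁻¹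
  have hM : M.IsHermitian := isHermitian_sqrt_mul_mul_sqrt Ω⁻¹ hΨ
  have log_det : Real.log (Ω + Ψ).det = Real.log Ω.det + Real.log (1 + M).det := by
    rw [det_add_eq_det_mul hΩ, Real.log_mul hΩ.det_pos.ne'
      (det_one_add_pos hM (hΨ_le.trans_lt (by norm_num))).ne']
  have trace_M : M.trace = (Ω⁻¹ * Ψ).trace :=
    trace_sqrt_mul_mul_sqrt hΩ.inv.posSemidef.nonneg Ψ
  have expansion : |Real.log (1 + M).det - M.trace + weightedNorm Ω⁻¹ Ψ ^ 2 / 2| ≤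
      2 * weightedNorm Ω⁻¹ Ψ ^ 3 := abs_log_det_one_add_sub_le hM hΨ_le
  calc _ = |(n : ℝ) / 2 * (Real.log (1 + M).det - M.trace + weightedNorm Ω⁻¹ Ψ ^ 2 / 2)| := by
        rw [logLik, logLik, log_det, trace_M, Matrix.add_mul, Matrix.sub_mul, Matrix.trace_add,
          Matrix.trace_sub, Matrix.trace_mul_comm Ψ]
        ring_nf
    _ = (n : ℝ) / 2 * |Real.log (1 + M).det - M.trace + weightedNorm Ω⁻¹ Ψ ^ 2 / 2| := by
        rw [abs_mul, abs_of_nonneg (by positivity)]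
    _ ≤ n / 2 * (2 * weightedNorm Ω⁻¹ Ψ ^ 3) := by gcongr
    _ = _ := by ring

/-- The error of the quadratic expansion of the Gaussian log-likelihood at a perturbation of size
`t / √n`, when the covariance matrix is within relative distance `e` of the reference one. -/
noncomputable def lanRemainder (n : ℕ) (t e : ℝ) : ℝ :=
  2 * t ^ 2 * (1 + e) ^ 3 * (Real.sqrt 2 * |t| / Real.sqrt n) + ((1 + e) ^ 2 - 1) * (t ^ 2 / 2)

lemma tendsto_sqrt_two_mul_abs_div_sqrt (t : ℝ) :
    Tendsto (fun n : ℕ => Real.sqrt 2 * |t| / Real.sqrt n) atTop (𝓝 0) :=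
  tendsto_const_nhds.div_atTop (Real.tendsto_sqrt_atTop.comp tendsto_natCast_atTop_atTop)

lemma tendsto_lanRemainder {e : ℕ → ℝ} (he : Tendsto e atTop (𝓝 0)) (t : ℝ) :
    Tendsto (fun n => lanRemainder n t (e n)) atTop (𝓝 0) := by
  have hfactor := he.const_add 1
  simpa [lanRemainder] using (((hfactor.pow 3).const_mul (2 * t ^ 2)).mul
    (tendsto_sqrt_two_mul_abs_div_sqrt t)).add
      (((hfactor.pow 2).sub_const 1).mul_const (t ^ 2 / 2))

lemma eventually_perturbation_le {e : ℕ → ℝ} (he : Tendsto e atTop (𝓝 0)) (t : ℝ) :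
    ∀ᶠ n : ℕ in atTop, (1 + e n) * (Real.sqrt 2 * |t| / Real.sqrt n) ≤ 1 / 2 := by
  have limit := (he.const_add 1).mul (tendsto_sqrt_two_mul_abs_div_sqrt t)
  rw [mul_zero] at limit
  exact limit.eventually_le_const (by norm_num)

lemma natCast_mul_sq_sqrt_div (hn : 0 < n) (t : ℝ) :
    n * (Real.sqrt 2 * |t| / Real.sqrt n) ^ 2 = 2 * t ^ 2 := by
  have hn' : (0 : ℝ) < n := Nat.cast_pos.2 hn
  rw [div_pow, mul_pow, Real.sq_sqrt hn'.le, Real.sq_sqrt zero_le_two, sq_abs]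
  field_simp

lemma mul_pow_three_add_abs_le_lanRemainder (hn : 0 < n) {q e t : ℝ} (hq0 : 0 ≤ q)
    (hq : |q - Real.sqrt 2 * |t| / Real.sqrt n| ≤ e * (Real.sqrt 2 * |t| / Real.sqrt n)) :
    n * q ^ 3 + |n / 4 * q ^ 2 - t ^ 2 / 2| ≤ lanRemainder n t e := by
  have n_mul_sq := natCast_mul_sq_sqrt_div hn t
  rw [lanRemainder]
  set a := Real.sqrt 2 * |t| / Real.sqrt n
  have q_le : q ≤ (1 + e) * a := by linarith [le_abs_self (q - a)]
  refine add_le_add ?_ ?_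
  · calc n * q ^ 3 ≤ n * ((1 + e) * a) ^ 3 := by gcongr
      _ = n * a ^ 2 * (1 + e) ^ 3 * a := by ring
      _ = _ := by rw [n_mul_sq]
  · calc |n / 4 * q ^ 2 - t ^ 2 / 2| = |(n : ℝ) / 4 * ((q - a) * (q + a))| := by
          rw [show t ^ 2 / 2 = n / 4 * a ^ 2 by linarith]
          ring_nf
      _ = n / 4 * (|q - a| * (q + a)) := by
          rw [abs_mul, abs_mul, abs_of_nonneg (by positivity : (0 : ℝ) ≤ n / 4),
            abs_of_nonneg (by positivity : 0 ≤ q + a)]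
      _ ≤ n / 4 * (e * a * ((1 + e) * a + a)) := by
          have := (abs_nonneg _).trans hq
          gcongr
      _ = ((1 + e) ^ 2 - 1) * (n * a ^ 2 / 4) := by ring
      _ = _ := by rw [n_mul_sq]; ring

lemma abs_logLik_perturbed_sub_le (hn : 0 < n) (x : Sample n p) (hS : S.PosDef) (hΩ : Ω.PosDef)
    (hΦ : Φ.IsHermitian) (hΦ0 : Φ ≠ 0) {e t : ℝ}
    (he : specNorm (Ω⁻¹ - S) * specNorm S⁻¹ ≤ e)
    (ht : (1 + e) * (Real.sqrt 2 * |t| / Real.sqrt n) ≤ 1 / 2) :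
    |logLik x (perturbed n S Φ t Ω) - logLik x Ω -
        (t * (Real.sqrt n * ((Ω⁻¹ - sampleCov x) * Φ).trace / (Real.sqrt 2 * weightedNorm S Φ))
          - t ^ 2 / 2)| ≤ lanRemainder n t e := by
  have hw := weightedNorm_pos hS hΦ0
  have hn' : (0 : ℝ) < n := Nat.cast_pos.2 hn
  set s := Real.sqrt 2 * t / (Real.sqrt n * weightedNorm S Φ) with hs
  set a := Real.sqrt 2 * |t| / Real.sqrt n with ha
  set q := weightedNorm Ω⁻¹ (s • Φ) with hq
  have score : t * (Real.sqrt n * ((Ω⁻¹ - sampleCov x) * Φ).trace /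
      (Real.sqrt 2 * weightedNorm S Φ)) = n / 2 * ((Ω⁻¹ - sampleCov x) * s • Φ).trace := by
    rw [Matrix.mul_smul, Matrix.trace_smul, smul_eq_mul, hs]
    field_simp
    rw [Real.sq_sqrt hn'.le, Real.sq_sqrt zero_le_two]
    ring
  have abs_s_mul : |s| * weightedNorm S Φ = a := by
    rw [hs, ha, abs_div, abs_mul, abs_of_pos (by positivity : 0 < Real.sqrt n * weightedNorm S Φ),
      abs_of_nonneg (Real.sqrt_nonneg 2)]
    field_simp
  have q_near : |q - a| ≤ e * a := by
    calc |q - a| = |s| * |weightedNorm Ω⁻¹ Φ - weightedNorm S Φ| := by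
          rw [hq, weightedNorm_smul, ← abs_s_mul, ← mul_sub, abs_mul, abs_abs]
      _ ≤ |s| * (e * weightedNorm S Φ) := by
          gcongr
          exact abs_weightedNorm_sub_le hS hΩ.inv hΦ he
      _ = e * a := by rw [mul_left_comm, abs_s_mul]
  have expansion := abs_logLik_add_sub_le x hΩ (hΦ.smul (IsSelfAdjoint.all s))
    (by linarith [le_abs_self (q - a)])
  rw [perturbed, ← hs, score]
  calc _ = |(logLik x (Ω + s • Φ) - logLik x Ω - (n / 2 * ((Ω⁻¹ - sampleCov x) * s • Φ).trace
          - n / 4 * q ^ 2)) - (n / 4 * q ^ 2 - t ^ 2 / 2)| := by ring_nf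
    _ ≤ n * q ^ 3 + |n / 4 * q ^ 2 - t ^ 2 / 2| := (abs_sub _ _).trans (by gcongr)
    _ ≤ _ := mul_pow_three_add_abs_le_lanRemainder hn (weightedNorm_nonneg _ _) q_near

lemma abs_logLik_perturbed_sub_le_of_linearization (hn : 0 < n) (x : Sample n p) (hS : S.PosDef)
    (hΩ : Ω.PosDef) (hΦ : Φ.IsHermitian) (hΦ0 : Φ ≠ 0) {e t κ ψ : ℝ}
    (he : specNorm (Ω⁻¹ - S) * specNorm S⁻¹ ≤ e)
    (ht : (1 + e) * (Real.sqrt 2 * |t| / Real.sqrt n) ≤ 1 / 2)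
    (hψ : Real.sqrt n * (weightedNorm S Φ)⁻¹ * |ψ - ((Ω⁻¹ - sampleCov x) * Φ).trace| ≤ κ) :
    |logLik x (perturbed n S Φ t Ω) - logLik x Ω -
        (t * (Real.sqrt n * ψ / (Real.sqrt 2 * weightedNorm S Φ)) - t ^ 2 / 2)| ≤
      lanRemainder n t e + |t| * κ := by
  have hw := weightedNorm_pos hS hΦ0
  set τ := ((Ω⁻¹ - sampleCov x) * Φ).trace
  set c := Real.sqrt 2 * weightedNorm S Φ with hc
  have linearization : |t * (Real.sqrt n * ψ / c) - t * (Real.sqrt n * τ / c)| ≤ |t| * κ := by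
    calc _ = |t| * (Real.sqrt n * (weightedNorm S Φ)⁻¹ * |ψ - τ| / Real.sqrt 2) := by
          rw [← mul_sub, ← sub_div, ← mul_sub, abs_mul, abs_div, abs_mul,
            abs_of_nonneg (Real.sqrt_nonneg _), abs_of_pos (by positivity : 0 < c), hc]
          field_simp
      _ ≤ |t| * (Real.sqrt n * (weightedNorm S Φ)⁻¹ * |ψ - τ|) := by
          gcongr
          exact div_le_self (by positivity) (Real.one_le_sqrt.2 one_le_two)
      _ ≤ |t| * κ := by gcongr
  calc _ ≤ _ := abs_sub_le _ (t * (Real.sqrt n * τ / c) - t ^ 2 / 2) _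
    _ ≤ _ := add_le_add (abs_logLik_perturbed_sub_le hn x hS hΩ hΦ hΦ0 he ht) ?_
  rwa [sub_sub_sub_cancel_right, abs_sub_comm]

end LikelihoodExpansion

section Tilting

variable {X : Type*} [MeasurableSpace X] {μ : Measure X} {f h T : X → ℝ} {A : Set X}

lemma measureReal_tilted [SFinite μ] (f : X → ℝ) (B : Set X) :
    (μ.tilted f).real B = (∫ x in B, Real.exp (f x) ∂μ) / ∫ x, Real.exp (f x) ∂μ := by
  rw [measureReal_def, tilted_apply_eq_ofReal_integral, integral_div, ENNReal.toReal_ofReal]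
  positivity

lemma isProbabilityMeasure_tilted_of_ne_zero (hf : μ.tilted f ≠ 0) :
    IsProbabilityMeasure (μ.tilted f) := by
  have : NeZero μ := ⟨fun hμ => hf (by rw [hμ, tilted_zero_measure])⟩
  exact isProbabilityMeasure_tilted (not_imp_comm.1 tilted_of_not_integrable hf)

lemma measureReal_restrict_tilted [SFinite μ] (hf : μ.tilted f ≠ 0) (hA : MeasurableSet A)
    (B : Set X) : ((μ.restrict A).tilted f).real B = (μ.tilted f)[|A].real B := by
  have : NeZero μ := ⟨fun hμ => hf (by rw [hμ, tilted_zero_measure])⟩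
  have normalizer_pos := integral_exp_pos (not_imp_comm.1 tilted_of_not_integrable hf)
  rw [measureReal_def (ProbabilityTheory.cond _ _), cond_apply hA, ENNReal.toReal_mul,
    ENNReal.toReal_inv, ← measureReal_def, ← measureReal_def, measureReal_tilted,
    measureReal_tilted, measureReal_tilted, Measure.restrict_restrict' hA, Set.inter_comm]
  field_simp

lemma abs_measureReal_sub_cond_le [IsProbabilityMeasure μ] (hA : MeasurableSet A) (B : Set X) :
    |μ.real B - μ[|A].real B| ≤ 1 - μ.real A := by
  have split := measureReal_inter_add_sdiff (μ := μ) (s := B) hA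
  have outside : μ.real (B \ A) ≤ 1 - μ.real A :=
    (measureReal_mono fun _ hx => hx.2).trans_eq (probReal_compl_eq_one_sub hA)
  have inside : μ.real (B ∩ A) = μ.real A * μ[|A].real B := by
    rw [Set.inter_comm, measureReal_def, ← cond_mul_eq_inter hA, ENNReal.toReal_mul, mul_comm]
    rfl
  have cond_le_one : μ[|A].real B ≤ 1 := measureReal_le_one
  have cond_nonneg : 0 ≤ μ[|A].real B := measureReal_nonneg
  have outside_nonneg : 0 ≤ μ.real (B \ A) := measureReal_nonneg
  rw [abs_le]
  constructor <;> nlinarith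

lemma mgf_tilted (f T : X → ℝ) (t : ℝ) :
    mgf T (μ.tilted f) t = (∫ x, Real.exp (f x + t * T x) ∂μ) / ∫ x, Real.exp (f x) ∂μ :=
  integral_exp_tilted f fun x => t * T x

lemma mgf_tilted_mem_Icc (hf : AEMeasurable f μ) (hT : AEMeasurable T μ)
    (hh : Integrable (fun x => Real.exp (h x)) μ) {t c r : ℝ}
    (hr : ∀ᵐ x ∂μ, |h x - f x - (t * T x - c)| ≤ r) :
    mgf T (μ.tilted f) t ∈ Set.Icc
      (Real.exp (c - r) * ((∫ x, Real.exp (h x) ∂μ) / ∫ x, Real.exp (f x) ∂μ))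
      (Real.exp (c + r) * ((∫ x, Real.exp (h x) ∂μ) / ∫ x, Real.exp (f x) ∂μ)) := by
  have lower : ∀ᵐ x ∂μ, Real.exp (c - r) * Real.exp (h x) ≤ Real.exp (f x + t * T x) := by
    filter_upwards [hr] with x hx
    rw [← Real.exp_add, Real.exp_le_exp]
    linarith [(abs_le.1 hx).2]
  have upper : ∀ᵐ x ∂μ, Real.exp (f x + t * T x) ≤ Real.exp (c + r) * Real.exp (h x) := by
    filter_upwards [hr] with x hx
    rw [← Real.exp_add, Real.exp_le_exp]
    linarith [(abs_le.1 hx).1]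
  have integrable : Integrable (fun x => Real.exp (f x + t * T x)) μ := by
    refine (hh.const_mul (Real.exp (c + r))).mono' (by fun_prop) ?_
    simpa only [Real.norm_eq_abs, Real.abs_exp] using upper
  rw [mgf_tilted, ← mul_div_assoc, ← mul_div_assoc, ← integral_const_mul, ← integral_const_mul]
  constructor
  · gcongr ?_ / _
    exact integral_mono_ae (hh.const_mul _) integrable lower
  · gcongr ?_ / _
    exact integral_mono_ae integrable (hh.const_mul _) upper

end Tilting

section TiltingLimits

variable {ι : Type*} {l : Filter ι} {X : ι → Type*} [∀ i, MeasurableSpace (X i)]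
  {μ : ∀ i, Measure (X i)} {T f h : ∀ i, X i → ℝ} {A : ∀ i, Set (X i)}

lemma tendsto_mgf_tilted (hf : ∀ i, AEMeasurable (f i) (μ i)) (hT : ∀ i, AEMeasurable (T i) (μ i))
    {t c : ℝ} {r : ι → ℝ} (hr : Tendsto r l (𝓝 0))
    (hr_le : ∀ᶠ i in l, ∀ᵐ x ∂μ i, |h i x - f i x - (t * T i x - c)| ≤ r i)
    (hratio : Tendsto (fun i => (∫ x, Real.exp (h i x) ∂μ i) / ∫ x, Real.exp (f i x) ∂μ i) l
      (𝓝 1)) :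
    Tendsto (fun i => mgf (T i) ((μ i).tilted (f i)) t) l (𝓝 (Real.exp c)) := by
  have bounds : ∀ᶠ i in l, mgf (T i) ((μ i).tilted (f i)) t ∈ Set.Icc
      (Real.exp (c - r i) * ((∫ x, Real.exp (h i x) ∂μ i) / ∫ x, Real.exp (f i x) ∂μ i))
      (Real.exp (c + r i) * ((∫ x, Real.exp (h i x) ∂μ i) / ∫ x, Real.exp (f i x) ∂μ i)) := by
    filter_upwards [hr_le, hratio.eventually_ne one_ne_zero] with i hi ratio_ne_zero
    refine mgf_tilted_mem_Icc (hf i) (hT i) ?_ hi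
    exact not_imp_comm.1 integral_undef (left_ne_zero_of_mul ratio_ne_zero)
  have lower := ((Real.continuous_exp.tendsto _).comp (hr.const_sub c)).mul hratio
  have upper := ((Real.continuous_exp.tendsto _).comp (hr.const_add c)).mul hratio
  rw [sub_zero, mul_one] at lower
  rw [add_zero, mul_one] at upper
  exact tendsto_of_tendsto_of_tendsto_of_le_of_le' lower upper (bounds.mono fun _ h => h.1)
    (bounds.mono fun _ h => h.2)

lemma exists_probabilityMeasure_eventually_eq {Y : Type*} [MeasurableSpace Y] [Nonempty Y]
    {Q : ι → Measure Y} (hQ : ∀ᶠ i in l, IsProbabilityMeasure (Q i)) :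
    ∃ ν : ι → ProbabilityMeasure Y, ∀ᶠ i in l, (ν i : Measure Y) = Q i := by
  have (i : ι) :
      ∃ ν : ProbabilityMeasure Y, IsProbabilityMeasure (Q i) → (ν : Measure Y) = Q i := by
    by_cases hi : IsProbabilityMeasure (Q i)
    · exact ⟨⟨Q i, hi⟩, fun _ => rfl⟩
    · exact ⟨⟨Measure.dirac (Classical.arbitrary Y), inferInstance⟩, fun h => (hi h).elim⟩
  choose ν hν using this
  exact ⟨ν, hQ.mono hν⟩

theorem tendstoUniformly_gaussian_of_tendsto_mgf {Q : ∀ i, Measure (X i)}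
    (hQ : ∀ᶠ i in l, IsProbabilityMeasure (Q i)) (hT : ∀ i, AEMeasurable (T i) (Q i))
    (hmgf : ∀ t, Tendsto (fun i => mgf (T i) (Q i) t) l (𝓝 (Real.exp (t ^ 2 / 2)))) :
    TendstoUniformly (fun i t => (Q i).real {x | T i x ≤ t})
      (fun t => (gaussianReal 0 1).real (Set.Iic t)) l := by
  obtain ⟨ν, hν⟩ := exists_probabilityMeasure_eventually_eq (Q := fun i => (Q i).map (T i))
    (hQ.mono fun i _ => Measure.isProbabilityMeasure_map (hT i))
  let γ : ProbabilityMeasure ℝ := ⟨gaussianReal 0 1, inferInstance⟩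
  have : NullSingletonClass (γ : Measure ℝ) := nullSingletonClass_gaussianReal one_ne_zero
  have mgf_γ (t : ℝ) : mgf id (γ : Measure ℝ) t = Real.exp (t ^ 2 / 2) := by
    simp [γ, mgf_id_gaussianReal]
  have weak : Tendsto ν l (𝓝 γ) := by
    refine tendsto_of_tendsto_mgf integrable_exp_mul_gaussianReal fun t => ?_
    rw [mgf_γ]
    refine (hmgf t).congr' (hν.mono fun i hi => ?_)
    simp only [hi, mgf_id_map (hT i)]
  have uniform := tendstoUniformly_cdf_of_tendsto weak
  simp only [TendstoUniformly, cdf_eq_real] at uniform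
  refine fun u hu => ?_
  filter_upwards [uniform u hu, hν] with i hi hνi t
  have close := hi t
  rw [hνi, map_measureReal_apply_of_aemeasurable (hT i) measurableSet_Iic] at close
  exact close

theorem tendstoUniformly_tilted_gaussian [∀ i, SFinite (μ i)]
    (hA : ∀ i, MeasurableSet (A i)) (hT : ∀ i, AEMeasurable (T i) (μ i))
    (hmass : Tendsto (fun i => ((μ i).tilted (f i)).real (A i)) l (𝓝 1))
    (hmgf : ∀ t, Tendsto (fun i => mgf (T i) (((μ i).restrict (A i)).tilted (f i)) t) l
      (𝓝 (Real.exp (t ^ 2 / 2)))) :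
    TendstoUniformly (fun i t => ((μ i).tilted (f i)).real {x | T i x ≤ t})
      (fun t => (gaussianReal 0 1).real (Set.Iic t)) l := by
  have tilted_prob : ∀ᶠ i in l, IsProbabilityMeasure ((μ i).tilted (f i)) := by
    filter_upwards [hmass.eventually_ne one_ne_zero] with i hi
    exact isProbabilityMeasure_tilted_of_ne_zero fun h0 => hi (by simp [h0])
  have restrict_prob : ∀ᶠ i in l, IsProbabilityMeasure (((μ i).restrict (A i)).tilted (f i)) := by
    filter_upwards [(hmgf 0).eventually_ne (Real.exp_ne_zero _)] with i hi
    exact isProbabilityMeasure_tilted_of_ne_zero fun h0 => hi (by simp [h0])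
  have restrict_uniform := tendstoUniformly_gaussian_of_tendsto_mgf restrict_prob
    (fun i => (hT i).restrict.mono_ac (tilted_absolutelyContinuous _ _)) hmgf
  rw [Metric.tendstoUniformly_iff] at restrict_uniform ⊢
  intro ε hε
  filter_upwards [tilted_prob, restrict_uniform (ε / 2) (half_pos hε),
    hmass.eventually_const_lt (show 1 - ε / 2 < 1 by linarith)] with i hprob hclose hi t
  have cond := abs_measureReal_sub_cond_le (μ := (μ i).tilted (f i)) (hA i) {x | T i x ≤ t}
  rw [← measureReal_restrict_tilted (IsProbabilityMeasure.ne_zero _) (hA i), abs_sub_comm] at cond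
  calc _ ≤ _ := dist_triangle _ (((μ i).restrict (A i)).tilted (f i) |>.real {x | T i x ≤ t}) _
    _ < ε / 2 + ε / 2 := add_lt_add_of_lt_of_le (hclose t) (cond.trans (by linarith))
    _ = ε := add_halves ε

end TiltingLimits

section Posterior

variable {n p : ℕ}

instance borelSpace_matrix : BorelSpace (Matrix (Fin p) (Fin p) ℝ) :=
  inferInstanceAs (BorelSpace (Fin p → Fin p → ℝ))

lemma measurable_logLik (x : Sample n p) : Measurable (logLik x) := by
  have trace : Continuous fun Ω : Matrix (Fin p) (Fin p) ℝ => (Ω * sampleCov x).trace := by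
    fun_prop
  have det : Continuous fun Ω : Matrix (Fin p) (Fin p) ℝ => Ω.det := by fun_prop
  exact ((Real.measurable_log.comp det.measurable).const_mul _).sub (trace.measurable.const_mul _)

lemma continuous_perturbed (S Φ : Matrix (Fin p) (Fin p) ℝ) (t : ℝ) :
    Continuous (perturbed n S Φ t) :=
  continuous_add_const _

lemma toReal_lintegral_exp_div_lintegral_exp {X : Type*} [MeasurableSpace X] {μ ν : Measure X}
    {f g : X → ℝ} (hf : Measurable f) (hg : Measurable g) :
    ((∫⁻ x, ENNReal.ofReal (Real.exp (f x)) ∂μ) /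
        ∫⁻ x, ENNReal.ofReal (Real.exp (g x)) ∂ν).toReal =
      (∫ x, Real.exp (f x) ∂μ) / ∫ x, Real.exp (g x) ∂ν := by
  rw [ENNReal.toReal_div,
    integral_eq_lintegral_of_nonneg_ae (.of_forall fun _ => Real.exp_nonneg _) (by fun_prop),
    integral_eq_lintegral_of_nonneg_ae (.of_forall fun _ => Real.exp_nonneg _) (by fun_prop)]

-- Where the normalizing integral is infinite, both conventions give `0`.
lemma posteriorProb_eq_measureReal_tilted (prior : Measure (Matrix (Fin p) (Fin p) ℝ))
    [SFinite prior] (x : Sample n p) (B : Set (Matrix (Fin p) (Fin p) ℝ)) :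
    posteriorProb prior x B = (prior.tilted (logLik x)).real B := by
  rw [measureReal_tilted]
  exact toReal_lintegral_exp_div_lintegral_exp (measurable_logLik x) (measurable_logLik x)

lemma likelihoodRatio_eq_integral_div (prior : Measure (Matrix (Fin p) (Fin p) ℝ))
    (x : Sample n p) (A : Set (Matrix (Fin p) (Fin p) ℝ)) (S Φ : Matrix (Fin p) (Fin p) ℝ)
    (t : ℝ) :
    likelihoodRatio prior x A S Φ t = (∫ Ω in A, Real.exp (logLik x (perturbed n S Φ t Ω)) ∂prior) /
      ∫ Ω in A, Real.exp (logLik x Ω) ∂prior :=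
  toReal_lintegral_exp_div_lintegral_exp
    ((measurable_logLik x).comp (continuous_perturbed S Φ t).measurable) (measurable_logLik x)

end Posterior

section Negligibility

lemma exists_tendsto_zero_forall_le {ι : Type*} {l : Filter ι} {X : ι → Type*}
    {s : ∀ i, Set (X i)} {g : ∀ i, X i → ℝ}
    (h : Tendsto (fun i => ⨆ x ∈ s i, ENNReal.ofReal (g i x)) l (𝓝 0)) :
    ∃ κ : ι → ℝ, Tendsto κ l (𝓝 0) ∧ ∀ᶠ i in l, ∀ x ∈ s i, g i x ≤ κ i := by
  refine ⟨fun i => (⨆ x ∈ s i, ENNReal.ofReal (g i x)).toReal,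
    by simpa only [Function.comp_def, ENNReal.toReal_zero] using
      (ENNReal.tendsto_toReal ENNReal.zero_ne_top).comp h, ?_⟩
  filter_upwards [h.eventually_ne ENNReal.zero_ne_top] with i hi x hx
  exact (ENNReal.ofReal_le_iff_le_toReal hi).1
    (le_iSup₂ (f := fun x (_ : x ∈ s i) => ENNReal.ofReal (g i x)) x hx)

lemma tendsto_mul_zero_of_max_isBigO_one {ι : Type*} {l : Filter ι} {δ a b : ι → ℝ}
    (hδ : Tendsto δ l (𝓝 0)) (hb : ∀ i, 0 ≤ b i)
    (hab : (fun i => max (a i) (b i)) =O[l] fun _ => (1 : ℝ)) :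
    Tendsto (fun i => δ i * b i) l (𝓝 0) := by
  have hb_bdd : b =O[l] fun _ => (1 : ℝ) := (IsBigO.of_norm_le fun i => by
    rw [Real.norm_of_nonneg (hb i), max_comm]
    exact le_max_left _ _).trans hab
  simpa only [mul_one, isLittleO_one_iff] using ((isLittleO_one_iff ℝ).2 hδ).mul_isBigO hb_bdd

end Negligibility

end CovBvM

theorem theorem1_general
    (p : ℕ → ℕ)
    (P : ∀ n, Measure (Sample n (p n)))
    (Sstar : ∀ n, Matrix (Fin (p n)) (Fin (p n)) ℝ)
    (hSstar : ∀ n, (Sstar n).PosDef)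
    (prior : ∀ n, Measure (Matrix (Fin (p n)) (Fin (p n)) ℝ))
    [∀ n, SFinite (prior n)]
    (φ : ∀ n, Matrix (Fin (p n)) (Fin (p n)) ℝ → ℝ)
    (hφ : ∀ n, AEMeasurable (fun Ω => φ n Ω⁻¹) (prior n))
    (Φ : ∀ n, Matrix (Fin (p n)) (Fin (p n)) ℝ)
    (hΦsymm : ∀ n, (Φ n).IsSymm)
    (hΦne : ∀ n, Φ n ≠ 0)
    (A : ∀ n, Set (Matrix (Fin (p n)) (Fin (p n)) ℝ))
    (hAmeas : ∀ n, MeasurableSet (A n))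
    (hApos : ∀ n, ∀ Ω ∈ A n, Ω.PosDef)
    (e : ℕ → ℝ) (he : Tendsto e atTop (𝓝 0))
    (hAe : ∀ n, ∀ Ω ∈ A n, specNorm (Ω⁻¹ - Sstar n) * specNorm (Sstar n)⁻¹ ≤ e n)
    (hlin : IsLittleOP P fun n x =>
      ⨆ Ω ∈ A n, ENNReal.ofReal
        (Real.sqrt n * (weightedNorm (Sstar n) (Φ n))⁻¹ *
          |φ n Ω⁻¹ - φ n (sampleCov x) - ((Ω⁻¹ - sampleCov x) * Φ n).trace|))
    (hpost : IsLittleOP P fun n x => ENNReal.ofReal |posteriorProb (prior n) x (A n) - 1|)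
    (hratio : ∀ t : ℝ, IsLittleOP P fun n x =>
      ENNReal.ofReal |likelihoodRatio (prior n) x (A n) (Sstar n) (Φ n) t - 1|) :
    IsLittleOP P fun n x =>
      ⨆ t : ℝ, ENNReal.ofReal
        |posteriorProb (prior n) x
            {Ω | Real.sqrt n * (φ n Ω⁻¹ - φ n (sampleCov x)) /
              (Real.sqrt 2 * weightedNorm (Sstar n) (Φ n)) ≤ t}
          - (gaussianReal 0 1).real (Set.Iic t)| := by
  simp only [isLittleOP_ofReal_abs_sub_iff, posteriorProb_eq_measureReal_tilted,
    likelihoodRatio_eq_integral_div] at hpost hratio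
  simp only [isLittleOP_iff_tendsto_highProb, posteriorProb_eq_measureReal_tilted] at hlin ⊢
  have hT (i : Σ n, Sample n (p n)) : AEMeasurable (fun Ω => Real.sqrt i.1 *
      (φ i.1 Ω⁻¹ - φ i.1 (sampleCov i.2)) / (Real.sqrt 2 * weightedNorm (Sstar i.1) (Φ i.1)))
      (prior i.1) := (((hφ i.1).sub_const _).const_mul _).div_const _
  obtain ⟨κ, hκ, linearization⟩ := exists_tendsto_zero_forall_le hlin
  refine tendsto_iSup_ofReal_abs_sub (tendstoUniformly_tilted_gaussian
    (fun i => hAmeas i.1) hT hpost fun t => ?_)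
  have remainder : Tendsto (fun i => lanRemainder i.1 t (e i.1) + |t| * κ i) (highProb P)
      (𝓝 0) := by
    simpa using ((tendsto_lanRemainder he t).comp tendsto_fst_highProb).add (hκ.const_mul |t|)
  refine tendsto_mgf_tilted (μ := fun i : Σ n, Sample n (p n) => (prior i.1).restrict (A i.1))
    (h := fun i Ω => logLik i.2 (perturbed i.1 (Sstar i.1) (Φ i.1) t Ω))
    (fun i => (measurable_logLik i.2).aemeasurable) (fun i => (hT i).restrict) remainder ?_
    (hratio t)
  filter_upwards [linearization, tendsto_fst_highProb.eventually (eventually_perturbation_le he t),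
    tendsto_fst_highProb.eventually (eventually_gt_atTop 0)] with i hκ_i small_i hn
  filter_upwards [ae_restrict_mem (hAmeas i.1)] with Ω hΩ
  exact abs_logLik_perturbed_sub_le_of_linearization hn i.2 (hSstar i.1) (hApos i.1 Ω hΩ)
    (Matrix.isHermitian_iff_isSymm.2 (hΦsymm i.1)) (hΦne i.1) (hAe i.1 Ω hΩ) small_i (hκ_i Ω hΩ)

theorem theorem1
    (p : ℕ → ℕ)
    (Sstar : ∀ n, Matrix (Fin (p n)) (Fin (p n)) ℝ)
    (hSstar : ∀ n, (Sstar n).PosDef)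
    (hbdd : (fun n => max (specNorm (Sstar n)) (specNorm (Sstar n)⁻¹))
      =O[atTop] (fun _ => (1 : ℝ)))
    (prior : ∀ n, Measure (Matrix (Fin (p n)) (Fin (p n)) ℝ))
    [∀ n, IsProbabilityMeasure (prior n)]
    (hprior : ∀ n, ∀ᵐ Ω ∂(prior n), Ω.PosDef)
    (φ : ∀ n, Matrix (Fin (p n)) (Fin (p n)) ℝ → ℝ)
    (hφ : ∀ n, AEMeasurable (fun Ω => φ n Ω⁻¹) (prior n))
    (Φ : ∀ n, Matrix (Fin (p n)) (Fin (p n)) ℝ)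
    (hΦsymm : ∀ n, (Φ n).IsSymm)
    (hΦne : ∀ n, Φ n ≠ 0)
    (A : ∀ n, Set (Matrix (Fin (p n)) (Fin (p n)) ℝ))
    (hAmeas : ∀ n, MeasurableSet (A n))
    (hApos : ∀ n, ∀ Ω ∈ A n, Ω.PosDef)
    (δ : ℕ → ℝ) (hδ : Tendsto δ atTop (𝓝 0))
    (hAδ : ∀ n, ∀ Ω ∈ A n, specNorm (Ω⁻¹ - Sstar n) ≤ δ n)
    (hlin : IsLittleOP (fun n => sampleLaw n (Sstar n)) fun n x =>
      ⨆ Ω ∈ A n, ENNReal.ofReal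
        (Real.sqrt n * (weightedNorm (Sstar n) (Φ n))⁻¹ *
          |φ n Ω⁻¹ - φ n (sampleCov x) - ((Ω⁻¹ - sampleCov x) * Φ n).trace|))
    (hpost : IsLittleOP (fun n => sampleLaw n (Sstar n)) fun n x =>
      ENNReal.ofReal |posteriorProb (prior n) x (A n) - 1|)
    (hratio : ∀ t : ℝ, IsLittleOP (fun n => sampleLaw n (Sstar n)) fun n x =>
      ENNReal.ofReal |likelihoodRatio (prior n) x (A n) (Sstar n) (Φ n) t - 1|) :
    IsLittleOP (fun n => sampleLaw n (Sstar n)) fun n x =>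
      ⨆ t : ℝ, ENNReal.ofReal
        |posteriorProb (prior n) x
            {Ω | Real.sqrt n * (φ n Ω⁻¹ - φ n (sampleCov x)) /
              (Real.sqrt 2 * weightedNorm (Sstar n) (Φ n)) ≤ t}
          - (gaussianReal 0 1).real (Set.Iic t)| :=
  theorem1_general p _ Sstar hSstar prior φ hφ Φ hΦsymm hΦne A hAmeas hApos _
    (tendsto_mul_zero_of_max_isBigO_one hδ (fun _ => norm_nonneg _) hbdd)
    (fun n Ω hΩ => mul_le_mul_of_nonneg_right (hAδ n Ω hΩ) (norm_nonneg _)) hlin hpost hratio
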